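/- **Theorem (entanglement-based bound for the long-time evolution of the observable error).** *Setting.* Let $H=\sum_{l=1}^L H_l$ with Hermitian operators $H_l$ on $N$ qubits, $d=2^N$, and let $\|\cdot\|$ denote the spectral norm of operators and the Euclidean norm of vectors. Write $U_0=U_0(\delta t)=e^{-iH\delta t}$, and let $$\mathscr U(\delta t)=\prod_{s=1}^{S}\prod_{l=1}^{L}e^{-i\,\delta t\,a_sH_{\pi_s(l)}}$$ be a product formula with real $a_s$ and permutations $\pi_s$ of $\{1,\dots,L\}$. We say that $M$ is its leading error at order $p$ if, as $\delta t\to0$, $$\mathscr U(\delta t)=e^{-iH\delta t}\bigl(I+M\,\delta t^{p+1}+\mathcal O(\delta t^{p+2})\bigr).$$ *Notation.* For an operator $A=\sum_jA_j$ and a vector $|\chi\rangle$ put $\|A\|_F^2=\operatorname{tr}(A^\dagger A)/d$ and $$\Delta_A(|\chi\rangle)=\sum_{j,j'}\|A_j^\dagger A_{j'}\|\sqrt{2\log\bigl(d_{\operatorname{supp}(A_j^\dagger A_{j'})}\bigr)-2S(\rho_{j,j'})},$$ where $\operatorname{supp}(B)$ is the set of qubits on which $B$ acts nontrivially, $d_S=2^{|S|}$,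 $\rho_{j,j'}=\operatorname{tr}_{[N]\setminus\operatorname{supp}(A_j^\dagger A_{j'})}|\chi\rangle\langle\chi|$, and $S(\rho)=-\operatorname{tr}(\rho\log\rho)$ (natural logarithms). *Claim.* (a) The first-order formula $\mathscr U_1(\delta t)=e^{-iH_1\delta t}\cdots e^{-iH_L\delta t}$ has a leading error at order $1$. For every $k\ge1$ the Suzuki formula $\mathscr U_{2k}$ has a leading error at order $2k$, where $\mathscr U_2(\delta t)=\bigl(e^{-iH_1\delta t/2}\cdots e^{-iH_L\delta t/2}\bigr)\bigl(e^{-iH_L\delta t/2}\cdots e^{-iH_1\delta t/2}\bigr)$ and, for $k>1$, $\mathscr U_{2k}(\delta t)=\mathscr U_{2k-2}(p_k\delta t)^2\,\mathscr U_{2k-2}((1-4p_k)\delta t)\,\mathscr U_{2k-2}(p_k\delta t)^2$ with $p_k=1/(4-4^{1/(2k-1)})$. (b) Let $p\ge1$ and let $\mathscr U_p$ be a product formula with leading error $M$ at order $p$. There are constants $C$ and $\delta_0>0$, depending only on the $H_l$, the formula, $p$ and $M$, such that the following holds for every Hermitian observable $O$, all finite decompositions $O=\sum_jO_j$ and $M=\sum_jM_j$,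 every unit vector $|\psi\rangle$, every $r\ge0$ and every $0<\delta t<\delta_0$. Let $\mathscr M$ be the multiplicative error of one step, defined by $\mathscr U_p=U_0(I+\mathscr M)$ or, alternatively, by $\mathscr U_p=(I+\mathscr M)U_0$. Then $$\Bigl|\langle\psi|\,(U_0^{r})^\dagger O\,U_0^r-(\mathscr U_p^{r})^\dagger O\,\mathscr U_p^r\,|\psi\rangle\Bigr|\le\sum_{k=0}^{r-1}\Bigl[\sqrt{\|O\|_F^2+\Delta_O(|\tilde\psi_{r_k}\rangle)}\sqrt{\|M\|_F^2+\Delta_M(|\psi_{k,O_k}\rangle)}+\sqrt{\|O\|_F^2+\Delta_O(|\tilde\psi_{r_k,\mathscr M}\rangle)}\sqrt{\|M\|_F^2+\Delta_M(|\psi_k\rangle)}\Bigr]\delta t^{p+1}+C\,r\,\|O\|\,\delta t^{p+2}.$$ In particular, for fixed $r$ and $O$ the remainder is $\mathcal O(\delta t^{p+2})$. Here $$|\psi_k\rangle=\mathscr U_p^{\,r-k}|\psi\rangle,\qquad |\tilde\psi_{r_k}\rangle=U_0^k\,\mathscr U_p^{\,r-k}|\psi\rangle,\qquad |\tilde\psi_{r_k,\mathscr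 M}\rangle=\frac{U_0^k\mathscr M\,\mathscr U_p^{\,r-k}|\psi\rangle}{\|U_0^k\mathscr M\,\mathscr U_p^{\,r-k}|\psi\rangle\|},\qquad |\psi_{k,O_k}\rangle=\frac{O_k|\psi_k\rangle}{\|O_k|\psi_k\rangle\|},$$ with $O_k=(U_0^{k})^\dagger O\,U_0^k$, and a normalised vector $v/\|v\|$ is read as $0$ when $v=0$. -/

import Mathlib

open scoped Matrix Matrix.Norms.L2Operator

noncomputable section

namespace Trotter

/-- Operators on `N` qubits, as matrices in the computational basis `{0,1}^N`.
The norm `‖A‖` on this type is the spectral norm (operator norm for the Euclidean norm). -/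
abbrev Op (N : ℕ) : Type := Matrix (Fin N → Fin 2) (Fin N → Fin 2) ℂ

/-- The Hilbert space `(ℂ²)^{⊗N}` of `N` qubits. -/
abbrev QState (N : ℕ) : Type := EuclideanSpace ℂ (Fin N → Fin 2)

/-- The vector `A|χ⟩`. -/
def act {N : ℕ} (A : Op N) (χ : QState N) : QState N :=
  Matrix.toEuclideanCLM (n := Fin N → Fin 2) (𝕜 := ℂ) A χ

/-- The normalised vector `v / ‖v‖`; it is `0` when `v = 0`. -/
def normalize {N : ℕ} (v : QState N) : QState N := ((‖v‖ : ℂ)⁻¹) • v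

/-! ### Supports, reduced states, entropy -/

/-- `A` acts as the identity on qubit `i`, i.e. `A = I_i ⊗ B` with `B` on the other qubits. -/
def ActsTriviallyAt {N : ℕ} (A : Op N) (i : Fin N) : Prop :=
  ∀ x y : Fin N → Fin 2,
    A x y = if x i = y i then A (Function.update x i 0) (Function.update y i 0) else 0

open Classical in
/-- The set of qubits on which `A` acts nontrivially. -/
def supp {N : ℕ} (A : Op N) : Finset (Fin N) :=
  Finset.univ.filter fun i => ¬ ActsTriviallyAt A i

/-- The bit string that is `a` on `S` and `c` off `S`. -/
def glue {N : ℕ} (S : Finset (Fin N)) (a : {i // i ∈ S} → Fin 2) (c : {i // i ∉ S} → Fin 2) :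
    Fin N → Fin 2 :=
  fun i => if h : i ∈ S then a ⟨i, h⟩ else c ⟨i, h⟩

/-- The reduced density matrix `tr_{[N] ∖ S} |χ⟩⟨χ|` on the qubits in `S`. -/
def reducedDensity {N : ℕ} (χ : QState N) (S : Finset (Fin N)) :
    Matrix ({i // i ∈ S} → Fin 2) ({i // i ∈ S} → Fin 2) ℂ :=
  Matrix.of fun a b => ∑ c : {i // i ∉ S} → Fin 2, χ (glue S a c) * star (χ (glue S b c))

theorem reducedDensity_isHermitian {N : ℕ} (χ : QState N) (S : Finset (Fin N)) :
    (reducedDensity χ S).IsHermitian := by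
  ext a b
  simp [reducedDensity, Matrix.conjTranspose_apply, mul_comm]

/-- The von Neumann entropy `S(ρ) = -tr(ρ log ρ)` (natural logarithm) of the reduced density
matrix of `|χ⟩⟨χ|` on the qubits in `S`: the entanglement entropy of `S`. -/
def entEntropy {N : ℕ} (χ : QState N) (S : Finset (Fin N)) : ℝ :=
  ∑ a, Real.negMulLog ((reducedDensity_isHermitian χ S).eigenvalues a)

/-- The square of the normalised Frobenius norm, `‖A‖_F² = tr(A†A) / 2^N`. -/
def frobSq {N : ℕ} (A : Op N) : ℝ := (Matrix.trace (Aᴴ * A)).re / 2 ^ N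

/-- The entanglement deficit
`Δ_A(χ) = ∑_{j,j'} ‖A_j† A_j'‖ √(2 log d_{supp(A_j† A_j')} - 2 S(ρ_{j,j'}))`
of the decomposition `A = ∑_j A_j`, where `ρ_{j,j'}` is the reduced state on `supp(A_j† A_j')`. -/
def deficit {N m : ℕ} (A : Fin m → Op N) (χ : QState N) : ℝ :=
  ∑ j, ∑ j', ‖(A j)ᴴ * A j'‖ *
    Real.sqrt (2 * Real.log (2 ^ (supp ((A j)ᴴ * A j')).card)
      - 2 * entEntropy χ (supp ((A j)ᴴ * A j')))

/-- `√(‖A‖_F² + Δ_A(χ))` for `A = ∑_j A_j`. -/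
def entFactor {N m : ℕ} (A : Fin m → Op N) (χ : QState N) : ℝ :=
  Real.sqrt (frobSq (∑ j, A j) + deficit A χ)

/-! ### Product formulas -/

/-- The ideal step `U₀ = e^{-iH δt}` with `H = ∑_l H_l`. -/
def idealStep {N L : ℕ} (H : Fin L → Op N) (δt : ℝ) : Op N :=
  NormedSpace.exp ((-(Complex.I * (δt : ℂ))) • ∑ l, H l)

/-- The product formula `∏_s ∏_l e^{-i δt a_s H_{π_s(l)}}` with stages `(a_s, π_s)`. -/
def productFormula {N L : ℕ} (H : Fin L → Op N) (stages : List (ℝ × Equiv.Perm (Fin L)))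
    (δt : ℝ) : Op N :=
  (stages.map fun s =>
    (List.ofFn fun l : Fin L =>
      NormedSpace.exp ((-(Complex.I * (δt : ℂ) * (s.1 : ℂ))) • H (s.2 l))).prod).prod

/-- The stages of the first-order formula `e^{-iH_1 δt} ⋯ e^{-iH_L δt}`. -/
def firstOrderStages (L : ℕ) : List (ℝ × Equiv.Perm (Fin L)) := [(1, 1)]

/-- Multiply all times of a list of stages by `c`. -/
def scaleStages {L : ℕ} (c : ℝ) (S : List (ℝ × Equiv.Perm (Fin L))) :
    List (ℝ × Equiv.Perm (Fin L)) :=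
  S.map fun s => (c * s.1, s.2)

/-- The stages of the Suzuki formula of order `2k`, indexed by `k - 1`:
`U_2(t) = (e^{-iH_1 t/2} ⋯ e^{-iH_L t/2}) (e^{-iH_L t/2} ⋯ e^{-iH_1 t/2})` and
`U_{2k}(t) = U_{2k-2}(p_k t)² U_{2k-2}((1 - 4 p_k) t) U_{2k-2}(p_k t)²` with
`p_k = 1 / (4 - 4^{1/(2k-1)})`. -/
def suzukiStages (L : ℕ) : ℕ → List (ℝ × Equiv.Perm (Fin L))
  | 0 => [(1 / 2, 1), (1 / 2, Fin.revPerm)]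
  | n + 1 =>
    let q : ℝ := 1 / (4 - (4 : ℝ) ^ ((1 : ℝ) / (2 * (n + 2 : ℝ) - 1)))
    let S := suzukiStages L n
    scaleStages q S ++ scaleStages q S ++ scaleStages (1 - 4 * q) S ++
      scaleStages q S ++ scaleStages q S

/-- `U(δt) = e^{-iH δt} (I + M δt^{p+1} + O(δt^{p+2}))` as `δt → 0`, for the product formula `U`
with the given stages: `M` is the leading coefficient of its multiplicative error at order `p`. -/
def IsLeadingError {N L : ℕ} (H : Fin L → Op N) (stages : List (ℝ × Equiv.Perm (Fin L)))
    (p : ℕ) (M : Op N) : Prop :=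
  ∃ R : ℝ → Op N,
    (∀ δt : ℝ, productFormula H stages δt =
      idealStep H δt * (1 + ((δt : ℂ) ^ (p + 1)) • M + R δt)) ∧
    R =O[nhds 0] fun δt : ℝ => δt ^ (p + 2)

/-! ### Observable error and hybrid states

Below `U₀` is the ideal step, `U` the approximate step and `E` the multiplicative error. -/

/-- The observable error `ε_O = |⟨ψ| (U₀^r)† O U₀^r - (U^r)† O U^r |ψ⟩|`. -/
def obsError {N : ℕ} (U₀ U O : Op N) (r : ℕ) (ψ : QState N) : ℝ :=
  ‖inner ℂ ψ (act ((U₀ ^ r)ᴴ * O * U₀ ^ r - (U ^ r)ᴴ * O * U ^ r) ψ)‖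

/-- `|ψ_k⟩ = U^{r-k} |ψ⟩`. -/
def stepState {N : ℕ} (U : Op N) (r k : ℕ) (ψ : QState N) : QState N :=
  act (U ^ (r - k)) ψ

/-- The hybrid state `U₀^k U^{r-k} |ψ⟩`. -/
def hybridState {N : ℕ} (U₀ U : Op N) (r k : ℕ) (ψ : QState N) : QState N :=
  act (U₀ ^ k * U ^ (r - k)) ψ

/-- The error-modified hybrid state `U₀^k E U^{r-k} |ψ⟩ / ‖U₀^k E U^{r-k} |ψ⟩‖`. -/
def hybridErrorState {N : ℕ} (U₀ U E : Op N) (r k : ℕ) (ψ : QState N) : QState N :=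
  normalize (act (U₀ ^ k * E * U ^ (r - k)) ψ)

/-- The state `O_k |ψ_k⟩ / ‖O_k |ψ_k⟩‖` with `O_k = (U₀^k)† O U₀^k`. -/
def stepObsState {N : ℕ} (U₀ U O : Op N) (r k : ℕ) (ψ : QState N) : QState N :=
  normalize (act ((U₀ ^ k)ᴴ * O * U₀ ^ k) (stepState U r k ψ))

end Trotter

end

namespace Trotter

open Asymptotics Filter

variable {N L : ℕ}

/-! ### Pinsker's inequality for the uniform distribution -/

/-! Expand `‖A χ‖²` as a double sum of expectations of `A_j† A_j'`. Each is the expectation of an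
operator on its support in a reduced state. Replacing that state by the maximally mixed one gives
the normalised trace, and these traces add up to `‖A‖_F²`. The cost of the replacement is at most
the operator norm times the trace distance, which Pinsker's inequality bounds by the entropy
deficit. Hence `‖A χ‖ ≤ entFactor A χ` for unit `χ` (`norm_act_le_entFactor`). The observable error
telescopes over the hybrid evolutions `U₀^k U^{r-k}`. With `U = (1 + F) U₀`, a step contributes the
expectation of `(1 + F) O_k (1 + F†) - O_k` in `ψ_k`. Unitarity of `1 + F` gives `F† = -F +
O(‖F‖²)`, so to leading order this is the commutator `[F, O_k]`, and `F` may be replaced by `E` or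
by `δt^{p+1} M` at cost `O(δt^{p+2})`. The two halves of the commutator are the two products of
factors in the bound (`norm_inner_step_le`). Leading errors come from Taylor expansion. For the
Suzuki formulas the choice of `p_k` cancels the odd coefficient, and time-reversal symmetry cancels
the next, even one; this raises the order by two per recursion (`exists_hasExpansion_suzukiStages`).
-/

theorem rational_le_log {x : ℝ} (hx : 0 < x) :
    (x - 1) * (5 * x + 1) / (2 * x * (x + 2)) ≤ Real.log x := by
  set g : ℝ → ℝ := fun x => Real.log x - (x - 1) * (5 * x + 1) / (2 * x * (x + 2)) with hg
  -- The rational function agrees with `log` to third order at `1`, so the derivative of the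
  -- difference has the sign of `(y - 1)^3` and `1` is the minimum.
  have hderiv : ∀ y : ℝ, 0 < y → HasDerivAt g ((y - 1) ^ 3 / (y ^ 2 * (y + 2) ^ 2)) y := by
    intro y hy
    have h1 := Real.hasDerivAt_log hy.ne'
    have hn : HasDerivAt (fun x : ℝ => (x - 1) * (5 * x + 1))
        (1 * (5 * y + 1) + (y - 1) * (5 * 1)) y :=
      ((hasDerivAt_id y).sub_const 1).mul (((hasDerivAt_id y).const_mul 5).add_const 1)
    have hd : HasDerivAt (fun x : ℝ => 2 * x * (x + 2)) (2 * 1 * (y + 2) + 2 * y * 1) y :=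
      ((hasDerivAt_id y).const_mul 2).mul ((hasDerivAt_id y).add_const 2)
    refine (h1.sub (hn.div hd (by positivity))).congr_deriv ?_
    field_simp
    ring
  have hcont : ContinuousOn g (Set.Ioi 0) := fun y hy =>
    (hderiv y hy).continuousAt.continuousWithinAt
  have h1 : g 1 = 0 := by simp [hg]
  suffices 0 ≤ g x by simpa [hg] using this
  rcases le_total 1 x with h | h
  · have hm : MonotoneOn g (Set.Ici 1) := by
      refine monotoneOn_of_deriv_nonneg (convex_Ici 1)
        (hcont.mono fun y hy => Set.mem_Ioi.2 (zero_lt_one.trans_le hy)) ?_ ?_ <;>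
        simp only [interior_Ici]
      · exact fun y hy => (hderiv y (zero_lt_one.trans hy)).differentiableAt.differentiableWithinAt
      · intro y hy
        rw [(hderiv y (zero_lt_one.trans hy)).deriv]
        have : 0 ≤ y - 1 := sub_nonneg.2 (Set.mem_Ioi.1 hy).le
        positivity
    rw [← h1]
    exact hm (Set.mem_Ici.2 le_rfl) h h
  · have hm : AntitoneOn g (Set.Ioc 0 1) := by
      refine antitoneOn_of_deriv_nonpos (convex_Ioc 0 1) (hcont.mono fun y hy => hy.1) ?_ ?_ <;>
        simp only [interior_Ioc]
      · exact fun y hy => (hderiv y hy.1).differentiableAt.differentiableWithinAt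
      · intro y hy
        rw [(hderiv y hy.1).deriv]
        have : (y - 1) ^ 3 ≤ 0 := Odd.pow_nonpos (by decide) (sub_nonpos.2 hy.2.le)
        exact div_nonpos_of_nonpos_of_nonneg this (by positivity)
    rw [← h1]
    exact hm ⟨hx, h⟩ ⟨one_pos, le_rfl⟩ h

theorem three_mul_sub_one_sq_le {x : ℝ} (hx : 0 ≤ x) :
    3 * (x - 1) ^ 2 ≤ (2 * x + 4) * (x * Real.log x - x + 1) := by
  rcases hx.eq_or_lt with rfl | hx
  · norm_num
  have h := rational_le_log hx
  rw [div_le_iff₀ (by positivity)] at h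
  nlinarith

/-- Pinsker's inequality against the uniform distribution. Cauchy–Schwarz is applied to the
pointwise bound `three_mul_sub_one_sq_le` at `x = d p_i`; the weights `(2x + 4)/3` sum to `2d`,
which yields the sharp constant `2`. -/
theorem sum_abs_sub_inv_card_le {ι : Type*} [Fintype ι] (p : ι → ℝ) (hp : ∀ i, 0 ≤ p i)
    (hsum : ∑ i, p i = 1) :
    ∑ i, |p i - (Fintype.card ι : ℝ)⁻¹| ≤
      Real.sqrt (2 * Real.log (Fintype.card ι) - 2 * ∑ i, Real.negMulLog (p i)) := by
  have hne : Nonempty ι := by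
    by_contra h
    rw [not_nonempty_iff] at h
    simp at hsum
  set d : ℝ := (Fintype.card ι : ℝ) with hd
  have hd0 : 0 < d := by simpa [hd] using Fintype.card_pos
  apply Real.le_sqrt_of_sq_le
  have hlog : ∀ i, d * p i * Real.log (d * p i) =
      d * (p i * Real.log d) - d * Real.negMulLog (p i) := by
    intro i
    rcases (hp i).eq_or_lt with h | h
    · simp [← h]
    · rw [Real.log_mul hd0.ne' h.ne', Real.negMulLog]
      ring
  have hcs := Finset.sum_sq_le_sum_mul_sum_of_sq_le_mul Finset.univ
    (r := fun i => |d * p i - 1|) (f := fun i => (2 * (d * p i) + 4) / 3)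
    (g := fun i => d * p i * Real.log (d * p i) - d * p i + 1)
    (fun i _ => by have := hp i; positivity)
    (fun i _ => by
      have h0 : 0 ≤ d * p i := mul_nonneg hd0.le (hp i)
      have h1 := three_mul_sub_one_sq_le h0
      by_contra hneg
      push Not at hneg
      nlinarith [sq_nonneg (d * p i - 1)])
    (fun i _ => by
      have h1 := three_mul_sub_one_sq_le (mul_nonneg hd0.le (hp i))
      rw [sq_abs]
      linarith)
  have hf : ∑ i, (2 * (d * p i) + 4) / 3 = 2 * d := by
    rw [← Finset.sum_div, Finset.sum_add_distrib, ← Finset.mul_sum, ← Finset.mul_sum, hsum]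
    simp [← hd]
    ring
  have hg : ∑ i, (d * p i * Real.log (d * p i) - d * p i + 1) =
      d * (Real.log d - ∑ i, Real.negMulLog (p i)) := by
    simp only [hlog]
    rw [Finset.sum_add_distrib, Finset.sum_sub_distrib, Finset.sum_sub_distrib, ← Finset.mul_sum,
      ← Finset.mul_sum, ← Finset.mul_sum, ← Finset.sum_mul, hsum]
    simp [← hd]
    ring
  have hr : ∑ i, |d * p i - 1| = d * ∑ i, |p i - d⁻¹| := by
    rw [Finset.mul_sum]
    refine Finset.sum_congr rfl fun i _ => ?_
    rw [← abs_of_pos hd0, ← abs_mul, abs_of_pos hd0, mul_sub, mul_inv_cancel₀ hd0.ne']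
  rw [hf, hg, hr] at hcs
  have hd2 : 0 < d ^ 2 := by positivity
  nlinarith

/-! ### Expectation values in a state close to the maximally mixed one -/

theorem norm_entry_le {n : Type*} [Fintype n] [DecidableEq n] (A : Matrix n n ℂ) (i j : n) :
    ‖A i j‖ ≤ ‖A‖ := by
  have h := (Matrix.toEuclideanCLM (n := n) (𝕜 := ℂ) A).le_opNorm (EuclideanSpace.single j 1)
  rw [Matrix.l2_opNorm_toEuclideanCLM, PiLp.norm_single, norm_one, mul_one] at h
  refine le_trans ?_ ((PiLp.norm_apply_le _ i).trans h)
  simp [Matrix.ofLp_toEuclideanCLM]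

/-- In an eigenbasis of `ρ` only the diagonal of `B` matters, and its entries are at most `‖B‖`;
what remains is the ℓ¹ distance of the spectrum from uniform. -/
theorem norm_trace_mul_sub_le {n : Type*} [Fintype n] [DecidableEq n] {ρ : Matrix n n ℂ}
    (hρ : ρ.IsHermitian) (hpos : ∀ i, 0 ≤ hρ.eigenvalues i) (htr : ρ.trace = 1) (B : Matrix n n ℂ) :
    ‖(B * ρ).trace - B.trace / Fintype.card n‖ ≤ ‖B‖ *
      Real.sqrt (2 * Real.log (Fintype.card n) - 2 * ∑ i, Real.negMulLog (hρ.eigenvalues i)) := by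
  set U : Matrix n n ℂ := (hρ.eigenvectorUnitary : Matrix n n ℂ) with hU
  have hUmem := hρ.eigenvectorUnitary.2
  have hUU : U * star U = 1 := Unitary.mul_star_self_of_mem hUmem
  have hsp : ρ = U * Matrix.diagonal (RCLike.ofReal ∘ hρ.eigenvalues) * star U := by
    have := hρ.spectral_theorem
    rwa [Unitary.conjStarAlgAut_apply] at this
  set c : Matrix n n ℂ := star U * B * U with hc
  have hcn : ‖c‖ ≤ ‖B‖ := by
    rw [hc, CStarRing.norm_mul_mem_unitary _ hUmem,
      CStarRing.norm_mem_unitary_mul _ (Unitary.star_mem hUmem)]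
  have hBtr : B.trace = ∑ i, c i i := by
    change _ = c.trace
    rw [hc, Matrix.trace_mul_comm, ← mul_assoc, hUU, one_mul]
  have hBρ : (B * ρ).trace = ∑ i, c i i * (hρ.eigenvalues i : ℂ) := by
    have : (B * ρ).trace = (c * Matrix.diagonal (RCLike.ofReal ∘ hρ.eigenvalues)).trace := by
      conv_lhs => rw [hsp]
      rw [hc, ← mul_assoc, Matrix.trace_mul_comm]
      simp only [mul_assoc]
    rw [this]
    simp [Matrix.trace, Matrix.mul_diagonal]
  have hsum : ∑ i, hρ.eigenvalues i = 1 := by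
    have := hρ.trace_eq_sum_eigenvalues
    rw [htr] at this
    simpa using (congrArg Complex.re this).symm
  have hpin := sum_abs_sub_inv_card_le _ hpos hsum
  have heq : (B * ρ).trace - B.trace / Fintype.card n =
      ∑ i, c i i * ((hρ.eigenvalues i - (Fintype.card n : ℝ)⁻¹ : ℝ) : ℂ) := by
    rw [hBρ, hBtr, Finset.sum_div, ← Finset.sum_sub_distrib]
    refine Finset.sum_congr rfl fun i _ => ?_
    push_cast
    ring
  rw [heq]
  calc _ ≤ ∑ i, ‖B‖ * |hρ.eigenvalues i - (Fintype.card n : ℝ)⁻¹| := by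
        refine (norm_sum_le _ _).trans (Finset.sum_le_sum fun i _ => ?_)
        rw [norm_mul, Complex.norm_real, Real.norm_eq_abs]
        gcongr
        exact (norm_entry_le c i i).trans hcn
    _ ≤ _ := by
        rw [← Finset.mul_sum]
        gcongr

/-! ### Partial traces -/

theorem apply_of_actsTriviallyAt (A : Op N) (T : Finset (Fin N))
    (hT : ∀ i ∈ T, ActsTriviallyAt A i) (x y : Fin N → Fin 2) :
    A x y = if ∀ i ∈ T, x i = y i then A (T.piecewise 0 x) (T.piecewise 0 y) else 0 := by
  classical
  induction T using Finset.induction with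
  | empty => simp
  | insert i T hi ih =>
    rw [ih fun j hj => hT j (Finset.mem_insert_of_mem hj),
      hT i (Finset.mem_insert_self i T) (T.piecewise 0 x)]
    simp only [Finset.piecewise_insert, Finset.forall_mem_insert,
      Finset.piecewise_eq_of_notMem _ _ _ hi, Pi.zero_apply]
    by_cases h1 : x i = y i <;> simp [h1]

theorem glue_eq_equiv (S : Finset (Fin N)) (a : {i // i ∈ S} → Fin 2)
    (c : {i // i ∉ S} → Fin 2) :
    glue S a c = (Equiv.piEquivPiSubtypeProd (· ∈ S) fun _ => Fin 2).symm (a, c) := rfl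

theorem sum_glue {β : Type*} [AddCommMonoid β] (S : Finset (Fin N)) (f : (Fin N → Fin 2) → β) :
    ∑ x, f x = ∑ a, ∑ c, f (glue S a c) := by
  rw [← Fintype.sum_prod_type', ← (Equiv.piEquivPiSubtypeProd (· ∈ S) fun _ => Fin 2).symm.sum_comp]
  rfl

theorem glue_injective_left (S : Finset (Fin N)) (c : {i // i ∉ S} → Fin 2) :
    Function.Injective fun a => glue S a c := by
  intro a a' h
  simpa [glue_eq_equiv] using h

/-- This says `A = B ⊗ I` with `B` on `S`; the bit string `0` off `S` is an arbitrary reference at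
which the matrix of `B` is read off. -/
theorem apply_glue {A : Op N} {S : Finset (Fin N)} (hS : supp A ⊆ S) (a a' : {i // i ∈ S} → Fin 2)
    (c c' : {i // i ∉ S} → Fin 2) :
    A (glue S a c) (glue S a' c') = if c = c' then A (glue S a 0) (glue S a' 0) else 0 := by
  have hT : ∀ i ∈ Sᶜ, ActsTriviallyAt A i := by
    intro i hi
    by_contra h
    exact Finset.mem_compl.1 hi (hS (by simp [supp, h]))
  have hpw : ∀ (b : {i // i ∈ S} → Fin 2) (e : {i // i ∉ S} → Fin 2),
      Sᶜ.piecewise 0 (glue S b e) = glue S b 0 := by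
    intro b e
    ext i
    by_cases hi : i ∈ S <;> simp [glue, hi]
  rw [apply_of_actsTriviallyAt A Sᶜ hT, hpw, hpw]
  refine if_congr ?_ rfl rfl
  constructor
  · intro h
    ext i
    have := h i.1 (Finset.mem_compl.2 i.2)
    simpa [glue, i.2] using congrArg Fin.val this
  · rintro rfl i hi
    simp [glue, Finset.mem_compl.1 hi]

/-- The submatrix is the compression `V† A V` by the isometry `V` that embeds basis vectors along
`f`. -/
theorem norm_submatrix_le {m n : Type*} [Fintype m] [Fintype n] [DecidableEq m] [DecidableEq n]
    (A : Matrix m m ℂ) {f : n → m} (hf : Function.Injective f) : ‖A.submatrix f f‖ ≤ ‖A‖ := by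
  set V : Matrix m n ℂ := (1 : Matrix m m ℂ).submatrix id f with hV
  have hVV : Vᴴ * V = 1 := by
    rw [hV, Matrix.conjTranspose_submatrix, Matrix.conjTranspose_one,
      ← Matrix.submatrix_mul _ _ f id f Function.bijective_id, one_mul, Matrix.submatrix_one f hf]
  have hA : A.submatrix f f = Vᴴ * A * V := by
    rw [hV, Matrix.conjTranspose_submatrix, Matrix.conjTranspose_one]
    ext i j
    simp [Matrix.mul_apply, Matrix.one_apply]
  have hVn : ‖V‖ * ‖V‖ ≤ 1 := by
    rw [← Matrix.l2_opNorm_conjTranspose_mul_self, hVV]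
    rcases isEmpty_or_nonempty n with h | h
    · rw [Subsingleton.elim (1 : Matrix n n ℂ) 0, norm_zero]
      exact zero_le_one
    · rw [CStarRing.norm_one]
  calc ‖A.submatrix f f‖ ≤ ‖Vᴴ‖ * ‖A‖ * ‖V‖ := by
        rw [hA]
        exact (Matrix.l2_opNorm_mul _ _).trans
          (mul_le_mul_of_nonneg_right (Matrix.l2_opNorm_mul _ _) (norm_nonneg _))
    _ = ‖V‖ * ‖V‖ * ‖A‖ := by
        rw [Matrix.l2_opNorm_conjTranspose]
        ring
    _ ≤ ‖A‖ := mul_le_of_le_one_left (norm_nonneg _) hVn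

theorem inner_act (χ φ : QState N) (A : Op N) :
    inner ℂ χ (act A φ) = ∑ x, ∑ y, star (χ x) * A x y * φ y := by
  simp only [act, PiLp.inner_apply, Matrix.ofLp_toEuclideanCLM, Matrix.mulVec, dotProduct,
    RCLike.inner_apply, Finset.sum_mul]
  refine Finset.sum_congr rfl fun x _ => Finset.sum_congr rfl fun y _ => ?_
  simp
  ring

theorem inner_act_eq_trace {A : Op N} {S : Finset (Fin N)} (hS : supp A ⊆ S) (χ : QState N) :
    inner ℂ χ (act A χ) =
      (A.submatrix (glue S · 0) (glue S · 0) * reducedDensity χ S).trace := by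
  simp only [inner_act, sum_glue S, Matrix.trace, Matrix.diag, Matrix.mul_apply,
    Matrix.submatrix_apply, reducedDensity, Matrix.of_apply, Finset.mul_sum]
  refine Finset.sum_congr rfl fun a _ => ?_
  rw [Finset.sum_comm]
  refine Finset.sum_congr rfl fun a' _ => Finset.sum_congr rfl fun c _ => ?_
  rw [Finset.sum_eq_single c (fun c' _ hc => by rw [apply_glue hS, if_neg hc.symm]; simp)
    (by simp), apply_glue hS, if_pos rfl]
  ring

theorem trace_eq_card_mul_trace {A : Op N} {S : Finset (Fin N)} (hS : supp A ⊆ S) :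
    A.trace / 2 ^ N = (A.submatrix (glue S · 0) (glue S · 0)).trace /
      Fintype.card ({i // i ∈ S} → Fin 2) := by
  have h : A.trace = Fintype.card ({i // i ∉ S} → Fin 2) *
      (A.submatrix (glue S · 0) (glue S · 0)).trace := by
    simp only [Matrix.trace, Matrix.diag, Matrix.submatrix_apply]
    rw [sum_glue S, Finset.mul_sum]
    refine Finset.sum_congr rfl fun a _ => ?_
    rw [Finset.sum_congr rfl fun c _ => by rw [apply_glue hS a a c c, if_pos rfl]]
    simp
  have hcard : (2 : ℂ) ^ N = Fintype.card ({i // i ∈ S} → Fin 2) *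
      Fintype.card ({i // i ∉ S} → Fin 2) := by
    have := Fintype.card_congr (Equiv.piEquivPiSubtypeProd (· ∈ S) fun _ : Fin N => Fin 2)
    rw [Fintype.card_prod] at this
    rw [← Nat.cast_mul, ← this, Fintype.card_fun, Fintype.card_fin, Fintype.card_fin, Nat.cast_pow,
      Nat.cast_ofNat]
  have h0 : (Fintype.card ({i // i ∉ S} → Fin 2) : ℂ) ≠ 0 := by simp
  have h1 : (Fintype.card ({i // i ∈ S} → Fin 2) : ℂ) ≠ 0 := by simp
  rw [h, hcard]
  field_simp

theorem reducedDensity_eigenvalues_nonneg (χ : QState N) (S : Finset (Fin N)) (a) :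
    0 ≤ (reducedDensity_isHermitian χ S).eigenvalues a := by
  -- The amplitudes of `χ` reshaped as a matrix across the bipartition; the reduced state is `X X†`.
  set X : Matrix ({i // i ∈ S} → Fin 2) ({i // i ∉ S} → Fin 2) ℂ :=
    Matrix.of fun a c => χ (glue S a c) with hX
  have h : reducedDensity χ S = X * Xᴴ := by
    ext a b
    simp [reducedDensity, hX, Matrix.mul_apply]
  open scoped ComplexOrder in
  have hpos : (reducedDensity χ S).PosSemidef := by
    rw [h]
    exact Matrix.posSemidef_self_mul_conjTranspose X
  exact hpos.eigenvalues_nonneg a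

theorem reducedDensity_trace (χ : QState N) (hχ : ‖χ‖ = 1) (S : Finset (Fin N)) :
    (reducedDensity χ S).trace = 1 := by
  have h := inner_self_eq_norm_sq_to_K (𝕜 := ℂ) χ
  rw [hχ, PiLp.inner_apply, sum_glue S] at h
  simpa [reducedDensity, Matrix.trace, Complex.mul_conj'] using h

/-- Both the expectation and the normalised trace of `A` are unchanged when `A` is cut down to its
support, so the entropy bound applies in dimension `2^{|supp A|}`. -/
theorem norm_inner_act_sub_trace_le (A : Op N) (χ : QState N) (hχ : ‖χ‖ = 1) :
    ‖inner ℂ χ (act A χ) - A.trace / 2 ^ N‖ ≤ ‖A‖ *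
      Real.sqrt (2 * Real.log (2 ^ (supp A).card) - 2 * entEntropy χ (supp A)) := by
  have h := norm_trace_mul_sub_le (reducedDensity_isHermitian χ (supp A))
    (reducedDensity_eigenvalues_nonneg χ _) (reducedDensity_trace χ hχ _)
    (A.submatrix (glue (supp A) · 0) (glue (supp A) · 0))
  rw [← inner_act_eq_trace subset_rfl, ← trace_eq_card_mul_trace subset_rfl] at h
  refine h.trans ?_
  have hc : (Fintype.card ({i // i ∈ supp A} → Fin 2) : ℝ) = 2 ^ (supp A).card := by simp
  rw [hc]
  exact mul_le_mul_of_nonneg_right (norm_submatrix_le A (glue_injective_left _ _))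
    (Real.sqrt_nonneg _)

/-! ### The norm of `A|χ⟩` -/

theorem act_mul (A B : Op N) (χ : QState N) : act (A * B) χ = act A (act B χ) := by
  simp [act]

theorem act_add (A B : Op N) (χ : QState N) : act (A + B) χ = act A χ + act B χ := by
  simp [act]

theorem act_sub (A B : Op N) (χ : QState N) : act (A - B) χ = act A χ - act B χ := by
  simp [act]

theorem act_smul (A : Op N) (c : ℂ) (χ : QState N) : act A (c • χ) = c • act A χ := by
  simp [act]

theorem smul_act (A : Op N) (c : ℂ) (χ : QState N) : act (c • A) χ = c • act A χ := by
  simp [act]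

theorem norm_act_le (A : Op N) (χ : QState N) : ‖act A χ‖ ≤ ‖A‖ * ‖χ‖ := by
  have := (Matrix.toEuclideanCLM (n := Fin N → Fin 2) (𝕜 := ℂ) A).le_opNorm χ
  rwa [Matrix.l2_opNorm_toEuclideanCLM] at this

theorem inner_act_left (A : Op N) (χ φ : QState N) :
    inner ℂ (act A χ) φ = inner ℂ χ (act Aᴴ φ) := by
  have : act Aᴴ = (Matrix.toEuclideanCLM (n := Fin N → Fin 2) (𝕜 := ℂ) A).adjoint := by
    funext v
    rw [← ContinuousLinearMap.star_eq_adjoint, ← map_star]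
    rfl
  rw [this, ContinuousLinearMap.adjoint_inner_right]
  rfl

theorem norm_act_sq_le {m : ℕ} (A : Fin m → Op N) (χ : QState N) (hχ : ‖χ‖ = 1) :
    ‖act (∑ j, A j) χ‖ ^ 2 ≤ frobSq (∑ j, A j) + deficit A χ := by
  have hmul : (∑ j, A j)ᴴ * ∑ j, A j = ∑ j, ∑ j', (A j)ᴴ * A j' := by
    rw [Matrix.conjTranspose_sum, Finset.sum_mul_sum]
  have hinner : inner ℂ χ (act ((∑ j, A j)ᴴ * ∑ j, A j) χ) =
      ∑ j, ∑ j', inner ℂ χ (act ((A j)ᴴ * A j') χ) := by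
    rw [hmul]
    simp only [act, map_sum, sum_apply, inner_sum]
  have hnorm : ‖act (∑ j, A j) χ‖ ^ 2 =
      (∑ j, ∑ j', inner ℂ χ (act ((A j)ᴴ * A j') χ)).re := by
    rw [← hinner, act_mul, ← inner_act_left, inner_self_eq_norm_sq_to_K]
    norm_cast
  have hfrob : frobSq (∑ j, A j) = (∑ j, ∑ j', ((A j)ᴴ * A j').trace / 2 ^ N).re := by
    have h2 : (2 : ℂ) ^ N = ((2 ^ N : ℝ) : ℂ) := by push_cast; rfl
    rw [frobSq, hmul]
    simp only [← Finset.sum_div, Matrix.trace_sum, h2, Complex.div_ofReal_re]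
  rw [hnorm, hfrob, ← sub_le_iff_le_add', ← Complex.sub_re]
  refine (Complex.re_le_norm _).trans ?_
  simp only [← Finset.sum_sub_distrib]
  refine (norm_sum_le _ _).trans (Finset.sum_le_sum fun j _ => ?_)
  exact (norm_sum_le _ _).trans
    (Finset.sum_le_sum fun j' _ => norm_inner_act_sub_trace_le _ χ hχ)

theorem norm_act_le_entFactor {m : ℕ} (A : Fin m → Op N) (χ : QState N) (hχ : ‖χ‖ = 1) :
    ‖act (∑ j, A j) χ‖ ≤ entFactor A χ :=
  Real.le_sqrt_of_sq_le (norm_act_sq_le A χ hχ)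

theorem norm_smul_normalize (v : QState N) : (‖v‖ : ℂ) • normalize v = v := by
  by_cases h : v = 0
  · simp [h, normalize]
  · rw [normalize, smul_smul, mul_inv_cancel₀ (by simpa using h), one_smul]

theorem norm_normalize {v : QState N} (hv : v ≠ 0) : ‖normalize v‖ = 1 := by
  have : ‖v‖ ≠ 0 := norm_ne_zero_iff.2 hv
  simp [normalize, norm_smul, this]

theorem norm_act_eq_norm_mul (A : Op N) (v : QState N) :
    ‖act A v‖ = ‖v‖ * ‖act A (normalize v)‖ := by
  conv_lhs => rw [← norm_smul_normalize v, act_smul, norm_smul]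
  simp

theorem norm_act_le_mul_entFactor {m : ℕ} (A : Fin m → Op N) (v : QState N) :
    ‖act (∑ j, A j) v‖ ≤ ‖v‖ * entFactor A (normalize v) := by
  by_cases h : v = 0
  · simp [h, act]
  · rw [norm_act_eq_norm_mul]
    gcongr
    exact norm_act_le_entFactor A _ (norm_normalize h)

/-! ### Taylor coefficients of analytic functions -/

theorem isBigO_pow_pow_of_le {m n : ℕ} (h : n ≤ m) :
    (fun t : ℝ => t ^ m) =O[nhds 0] fun t : ℝ => t ^ n := by
  refine IsBigO.of_bound 1 ?_
  filter_upwards [Metric.ball_mem_nhds (0 : ℝ) one_pos] with t ht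
  rw [norm_pow, norm_pow, one_mul]
  exact pow_le_pow_of_le_one (norm_nonneg _) (by simpa using (Metric.mem_ball.1 ht).le) h

section Analytic

variable {E : Type*} [NormedAddCommGroup E] [NormedSpace ℝ E]

theorem eq_zero_of_pow_smul_isBigO {m : ℕ} {M : E}
    (h : (fun t : ℝ => t ^ m • M) =O[nhds 0] fun t => t ^ (m + 1)) : M = 0 := by
  have h1 : (fun t : ℝ => t ^ m • M) =O[nhdsWithin 0 {0}ᶜ] fun t => t ^ m * t := by
    simpa only [pow_succ] using h.mono nhdsWithin_le_nhds
  have h2 : (fun _ : ℝ => M) =O[nhdsWithin 0 {0}ᶜ] fun t : ℝ => t := by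
    obtain ⟨c, hc⟩ := h1.bound
    refine IsBigO.of_bound c ?_
    filter_upwards [hc, self_mem_nhdsWithin] with t ht ht0
    have hpos : 0 < ‖t ^ m‖ := norm_pos_iff.2 (pow_ne_zero _ ht0)
    rw [norm_smul, norm_mul] at ht
    refine le_of_mul_le_mul_left ?_ hpos
    linarith
  have h3 : Tendsto (fun _ : ℝ => M) (nhdsWithin 0 {0}ᶜ) (nhds 0) :=
    h2.trans_tendsto (tendsto_id.mono_left nhdsWithin_le_nhds)
  exact tendsto_nhds_unique tendsto_const_nhds h3

/-- The growth bound forces vanishing order at least `m`: a smaller order `n` would leave a nonzero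
coefficient of `t^n`. The required `M` is then the value at `0` of the cofactor of `t^m`. -/
theorem exists_sub_pow_smul_isBigO {f : ℝ → E} (hf : AnalyticAt ℝ f 0) {m : ℕ}
    (h : f =O[nhds 0] fun t => t ^ m) :
    ∃ M : E, (fun t => f t - t ^ m • M) =O[nhds 0] fun t => t ^ (m + 1) := by
  have key : ∀ {n : ℕ} {g : ℝ → E}, AnalyticAt ℝ g 0 →
      (∀ᶠ t in nhds 0, f t = (t - 0) ^ n • g t) →
      (fun t => f t - t ^ n • g 0) =O[nhds 0] fun t => t ^ (n + 1) := by
    intro n g hg hfg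
    have h1 : (fun t => g t - g 0) =O[nhds 0] fun t : ℝ => t := by
      simpa using hg.differentiableAt.isBigO_sub
    refine (((isBigO_refl (fun t : ℝ => t ^ n) (nhds 0)).smul h1).congr' ?_ ?_)
    · filter_upwards [hfg] with t ht
      rw [ht, sub_zero, smul_sub]
    · exact Eventually.of_forall fun t => by simp [pow_succ]
  have hord : (m : ℕ∞) ≤ analyticOrderAt f 0 := by
    by_contra hlt
    push Not at hlt
    obtain ⟨n, hn⟩ := ENat.ne_top_iff_exists.1 hlt.ne_top
    rw [← hn, Nat.cast_lt] at hlt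
    obtain ⟨g, hg, hg0, hfg⟩ := hf.analyticOrderAt_eq_natCast.1 hn.symm
    refine hg0 (eq_zero_of_pow_smul_isBigO (m := n) ?_)
    have hm : f =O[nhds 0] fun t => t ^ (n + 1) :=
      h.trans (isBigO_pow_pow_of_le hlt)
    simpa using hm.sub (key hg hfg)
  obtain ⟨g, hg, hfg⟩ := (natCast_le_analyticOrderAt hf).1 hord
  exact ⟨g 0, key hg hfg⟩

theorem isBigO_sq_of_hasDerivAt_zero {f : ℝ → E} (hf : AnalyticAt ℝ f 0) (h0 : f 0 = 0)
    (h1 : HasDerivAt f 0 0) : f =O[nhds 0] fun t => t ^ 2 := by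
  have hO : f =O[nhds 0] fun t => t ^ 1 := by
    simpa [h0] using hf.differentiableAt.isBigO_sub
  obtain ⟨M, hM⟩ := exists_sub_pow_smul_isBigO hf hO
  have hd : HasDerivAt f M 0 := by
    rw [hasDerivAt_iff_isLittleO_nhds_zero]
    refine ((by simpa [h0] using hM : (fun t => f t - t • M) =O[nhds 0] fun t : ℝ => t ^ 2)
      |>.trans_isLittleO ?_).congr_left (fun t => by simp [h0])
    simpa using isLittleO_pow_pow (𝕜 := ℝ) one_lt_two
  rw [hd.unique h1] at hM
  simpa using hM

end Analytic

/-! ### Unitary evolutions -/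

/-- The evolution `e^{-iKt}` generated by `K`. -/
noncomputable def evolution (K : Op N) (t : ℝ) : Op N := 
  NormedSpace.exp ((-(Complex.I * (t : ℂ))) • K)

theorem evolution_zero (K : Op N) : evolution K 0 = 1 := by simp [evolution]

theorem evolution_add (K : Op N) (s t : ℝ) :
    evolution K (s + t) = evolution K s * evolution K t := by
  rw [evolution, evolution, evolution, ← Matrix.exp_add_of_commute, ← add_smul]
  · push_cast
    ring_nf
  · exact ((Commute.refl K).smul_left _).smul_right _

theorem evolution_neg_mul (K : Op N) (t : ℝ) : evolution K (-t) * evolution K t = 1 := by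
  rw [← evolution_add, neg_add_cancel, evolution_zero]

theorem evolution_mul_neg (K : Op N) (t : ℝ) : evolution K t * evolution K (-t) = 1 := by
  rw [← evolution_add, add_neg_cancel, evolution_zero]

theorem evolution_eq (K : Op N) (t : ℝ) :
    evolution K t = NormedSpace.exp (t • ((-Complex.I) • K)) := by
  rw [evolution, ← Complex.coe_smul, smul_smul]
  ring_nf

theorem evolution_smul (K : Op N) (c t : ℝ) : evolution ((c : ℂ) • K) t = evolution K (c * t) := by
  rw [evolution, evolution, smul_smul]
  push_cast
  ring_nf

theorem evolution_mem_unitary {K : Op N} (hK : K.IsHermitian) (t : ℝ) :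
    evolution K t ∈ unitary (Op N) := by
  have h : star (evolution K t) = evolution K (-t) := by
    rw [Matrix.star_eq_conjTranspose, evolution, ← Matrix.exp_conjTranspose,
      Matrix.conjTranspose_smul, hK.eq, evolution]
    simp
  rw [Unitary.mem_iff, h]
  exact ⟨evolution_neg_mul K t, evolution_mul_neg K t⟩

/-- `f` is analytic at `0` with `f(t) = 1 + t A + O(t²)`. -/
structure IsStep (f : ℝ → Op N) (A : Op N) : Prop where
  analyticAt : AnalyticAt ℝ f 0
  apply_zero : f 0 = 1
  hasDerivAt : HasDerivAt f A 0

theorem IsStep.one : IsStep (fun _ => (1 : Op N)) 0 :=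
  ⟨analyticAt_const, rfl, hasDerivAt_const _ _⟩

theorem IsStep.mul {f g : ℝ → Op N} {A B : Op N} (hf : IsStep f A) (hg : IsStep g B) :
    IsStep (fun t => f t * g t) (A + B) where
  analyticAt := hf.analyticAt.mul hg.analyticAt
  apply_zero := by rw [hf.apply_zero, hg.apply_zero, one_mul]
  hasDerivAt := by
    have h := hf.hasDerivAt.mul hg.hasDerivAt
    rw [hf.apply_zero, hg.apply_zero, mul_one, one_mul] at h
    exact h

theorem IsStep.list_prod {ι : Type*} {f : ι → ℝ → Op N} {A : ι → Op N}
    (h : ∀ i, IsStep (f i) (A i)) (l : List ι) :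
    IsStep (fun t => (l.map fun i => f i t).prod) (l.map A).sum := by
  induction l with
  | nil => exact IsStep.one
  | cons i l ih => simpa using (h i).mul ih

theorem IsStep.isBigO_sub_one {f : ℝ → Op N} {A : Op N} (hf : IsStep f A) :
    (fun t => f t - 1) =O[nhds 0] fun t : ℝ => t := by
  simpa [hf.apply_zero] using hf.hasDerivAt.differentiableAt.isBigO_sub

theorem isStep_evolution (K : Op N) : IsStep (evolution K) ((-Complex.I) • K) where
  analyticAt := by
    have h : evolution K = fun t : ℝ => NormedSpace.exp (t • ((-Complex.I) • K)) :=
      funext (evolution_eq K)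
    rw [h]
    exact (NormedSpace.exp_analytic (𝕂 := ℝ) _).comp (analyticAt_id.smul analyticAt_const)
  apply_zero := evolution_zero K
  hasDerivAt := by
    have h := hasDerivAt_exp_smul_const (𝕂 := ℝ) ((-Complex.I) • K) 0
    rw [zero_smul, NormedSpace.exp_zero, one_mul] at h
    exact h.congr_of_eventuallyEq (Eventually.of_forall (evolution_eq K))

theorem isBigO_evolution_mul_sub_one (K : Op N) (a : ℝ) :
    (fun t => evolution K (a * t) - 1) =O[nhds 0] fun t : ℝ => t := by
  simpa only [evolution_smul] using (isStep_evolution ((a : ℂ) • K)).isBigO_sub_one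

/-! ### Product formulas -/

theorem productFormula_eq (H : Fin L → Op N) (stages : List (ℝ × Equiv.Perm (Fin L))) (t : ℝ) :
    productFormula H stages t = (stages.map fun s =>
      ((List.finRange L).map fun l => evolution ((s.1 : ℂ) • H (s.2 l)) t).prod).prod := by
  simp only [productFormula, evolution, smul_smul, List.ofFn_eq_map, neg_mul]

/-- To first order the factors commute, so each stage contributes `a_s ∑ H_l` whatever its
permutation. -/
theorem isStep_productFormula (H : Fin L → Op N) (stages : List (ℝ × Equiv.Perm (Fin L))) :
    IsStep (productFormula H stages)
      ((-(Complex.I * ((stages.map Prod.fst).sum : ℝ))) • ∑ l, H l) := by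
  have h := IsStep.list_prod (fun s : ℝ × Equiv.Perm (Fin L) => IsStep.list_prod
    (fun l => isStep_evolution ((s.1 : ℂ) • H (s.2 l))) (List.finRange L)) stages
  rw [show productFormula H stages = _ from funext (productFormula_eq H stages)]
  convert h using 1
  clear h
  induction stages with
  | nil => simp
  | cons s stages ih =>
    simp only [List.map_cons, List.sum_cons]
    rw [← ih, ← List.ofFn_eq_map, List.sum_ofFn,
      ← Finset.smul_sum, ← Finset.smul_sum, Equiv.sum_comp s.2 H, smul_smul, ← add_smul]
    push_cast
    ring_nf

theorem productFormula_mem_unitary {H : Fin L → Op N} (hH : ∀ l, (H l).IsHermitian)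
    (stages : List (ℝ × Equiv.Perm (Fin L))) (t : ℝ) :
    productFormula H stages t ∈ unitary (Op N) := by
  rw [productFormula_eq]
  refine list_prod_mem fun U hU => ?_
  obtain ⟨s, -, rfl⟩ := List.mem_map.1 hU
  refine list_prod_mem fun V hV => ?_
  obtain ⟨l, -, rfl⟩ := List.mem_map.1 hV
  rw [evolution_smul]
  exact evolution_mem_unitary (hH _) _

theorem idealStep_mem_unitary {H : Fin L → Op N} (hH : ∀ l, (H l).IsHermitian) (t : ℝ) :
    idealStep H t ∈ unitary (Op N) := by
  refine evolution_mem_unitary (K := ∑ l, H l) ?_ t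
  rw [Matrix.IsHermitian, Matrix.conjTranspose_sum]
  exact Finset.sum_congr rfl fun l _ => hH l

theorem productFormula_append (H : Fin L → Op N) (S T : List (ℝ × Equiv.Perm (Fin L))) (t : ℝ) :
    productFormula H (S ++ T) t = productFormula H S t * productFormula H T t := by
  simp [productFormula]

theorem productFormula_scaleStages (H : Fin L → Op N) (c : ℝ)
    (S : List (ℝ × Equiv.Perm (Fin L))) (t : ℝ) :
    productFormula H (scaleStages c S) t = productFormula H S (c * t) := by
  simp only [productFormula_eq, scaleStages, List.map_map, Function.comp_def, evolution_smul]
  simp only [mul_assoc, mul_left_comm c]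

/-! ### Expansions around the exact evolution -/

/-- `f(t) = e^{-iKat} + t^m M + O(t^{m+1})` as `t → 0`. -/
def HasExpansion (K : Op N) (m : ℕ) (f : ℝ → Op N) (a : ℝ) (M : Op N) : Prop :=
  (fun t : ℝ => f t - evolution K (a * t) - t ^ m • M) =O[nhds 0] fun t : ℝ => t ^ (m + 1)

theorem isBigO_pow_smul (m : ℕ) (M : Op N) :
    (fun t : ℝ => t ^ m • M) =O[nhds 0] fun t : ℝ => t ^ m := by
  have h : (fun _ : ℝ => M) =O[nhds 0] fun _ : ℝ => (1 : ℝ) :=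
    isBigO_const_const M one_ne_zero _
  simpa using (isBigO_refl (fun t : ℝ => t ^ m) (nhds 0)).smul h

theorem HasExpansion.isBigO_sub_one {K : Op N} {m : ℕ} (hm : 1 ≤ m) {f : ℝ → Op N} {a : ℝ}
    {M : Op N} (h : HasExpansion K m f a M) : (fun t => f t - 1) =O[nhds 0] fun t : ℝ => t := by
  have h1 := (isBigO_pow_smul m M).trans (isBigO_pow_pow_of_le hm)
  have h2 := h.trans (isBigO_pow_pow_of_le (Nat.le_add_left 1 m))
  simp only [pow_one] at h1 h2
  refine ((h2.add h1).add (isBigO_evolution_mul_sub_one K a)).congr_left fun t => ?_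
  abel

theorem isBigO_one_of_isBigO_sub_one {f : ℝ → Op N}
    (h : (fun t => f t - 1) =O[nhds 0] fun t : ℝ => t) :
    f =O[nhds 0] fun _ : ℝ => (1 : ℝ) := by
  have h1 : (fun t : ℝ => t) =O[nhds 0] fun _ : ℝ => (1 : ℝ) :=
    (continuous_id.tendsto' 0 0 rfl).isBigO_one ℝ
  refine ((h.trans h1).add (isBigO_const_const (1 : Op N) one_ne_zero _)).congr_left fun t => ?_
  abel

theorem HasExpansion.mul {K : Op N} {m : ℕ} (hm : 1 ≤ m) {f g : ℝ → Op N} {a b : ℝ} {A B : Op N}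
    (hf : HasExpansion K m f a A) (hg : HasExpansion K m g b B) :
    HasExpansion K m (fun t => f t * g t) (a + b) (A + B) := by
  have hg1 := hg.isBigO_sub_one hm
  have hg0 := isBigO_one_of_isBigO_sub_one hg1
  have ha1 := isBigO_evolution_mul_sub_one K a
  have ha0 := isBigO_one_of_isBigO_sub_one ha1
  -- With `X = t^m A`, `Y = t^m B` and exact evolutions `V_a`, `V_b`, the remainder is `(f - V_a -
  -- X) g + V_a (g - V_b - Y) + X (g - 1) + (V_a - 1) Y`; each term is `O(t^{m+1})`.
  have e1 := IsBigO.mul hf hg0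
  have e2 := ha0.mul hg
  have e3 := (isBigO_pow_smul m A).mul hg1
  have e4 := ha1.mul (isBigO_pow_smul m B)
  simp only [mul_one, one_mul, ← pow_succ, ← pow_succ'] at e1 e2 e3 e4
  refine (((e1.add e2).add e3).add e4).congr_left fun t => ?_
  rw [add_mul, evolution_add, smul_add]
  generalize t ^ m • A = X
  generalize t ^ m • B = Y
  noncomm_ring

theorem HasExpansion.comp_mul {K : Op N} {m : ℕ} {f : ℝ → Op N} {a : ℝ} {M : Op N}
    (h : HasExpansion K m f a M) (c : ℝ) :
    HasExpansion K m (fun t => f (c * t)) (c * a) (c ^ m • M) := by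
  have hc : Tendsto (fun t : ℝ => c * t) (nhds 0) (nhds 0) :=
    (continuous_const_mul c).tendsto' _ _ (mul_zero c)
  have h1 : (fun t : ℝ => (c * t) ^ (m + 1)) =O[nhds 0] fun t : ℝ => t ^ (m + 1) := by
    simpa only [mul_pow] using (isBigO_refl (fun t : ℝ => t ^ (m + 1)) (nhds 0)).const_mul_left _
  refine ((IsBigO.comp_tendsto h hc).trans h1).congr_left fun t => ?_
  simp only [Function.comp_apply, mul_pow, smul_smul]
  rw [mul_comm (t ^ m), mul_left_comm a, mul_assoc]

/-- For even `m` the coefficients at `-t` and `t` agree, so `f(-t) f(t) = 1 + 2 t^m M + O(t^{m+1})`;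
as the product is `1`, `M` vanishes. -/
theorem HasExpansion.eq_zero_of_symmetric {K : Op N} {m : ℕ} (hm : 1 ≤ m) (heven : Even m)
    {f : ℝ → Op N} {M : Op N} (h : HasExpansion K m f 1 M) (hsymm : ∀ t, f (-t) * f t = 1) :
    M = 0 := by
  have h2 := (h.comp_mul (-1)).mul hm h
  have h3 : (fun t : ℝ => -(t ^ m • (M + M))) =O[nhds 0] fun t : ℝ => t ^ (m + 1) := by
    refine h2.congr_left fun t => ?_
    simp [hsymm, evolution_zero, heven.neg_one_pow]
  have h4 := eq_zero_of_pow_smul_isBigO h3.of_neg_left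
  rw [← two_smul ℝ] at h4
  exact (smul_eq_zero.1 h4).resolve_left two_ne_zero

theorem exists_hasExpansion (H : Fin L → Op N) (stages : List (ℝ × Equiv.Perm (Fin L))) {m : ℕ}
    (h : (fun t => productFormula H stages t - idealStep H t) =O[nhds 0] fun t : ℝ => t ^ m) :
    ∃ M, HasExpansion (∑ l, H l) m (productFormula H stages) 1 M := by
  obtain ⟨M, hM⟩ := exists_sub_pow_smul_isBigO
    ((isStep_productFormula H stages).analyticAt.sub (isStep_evolution (∑ l, H l)).analyticAt) h
  refine ⟨M, hM.congr_left fun t => ?_⟩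
  simp

theorem HasExpansion.isBigO_sub {H : Fin L → Op N} {m : ℕ} {f : ℝ → Op N}
    (h : HasExpansion (∑ l, H l) m f 1 0) :
    (fun t => f t - idealStep H t) =O[nhds 0] fun t : ℝ => t ^ (m + 1) := by
  refine IsBigO.congr_left h fun t => ?_
  simp [idealStep, evolution]

/-- Multiplying by `e^{iKt} = 1 + O(t)` turns the additive error into the multiplicative one without
changing its leading coefficient. -/
theorem HasExpansion.isLeadingError {H : Fin L → Op N} {stages : List (ℝ × Equiv.Perm (Fin L))}
    {p : ℕ} {M : Op N} (h : HasExpansion (∑ l, H l) (p + 1) (productFormula H stages) 1 M) :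
    IsLeadingError H stages p M := by
  set K := ∑ l, H l with hK
  refine ⟨fun t => evolution K (-t) * productFormula H stages t - 1 - ((t : ℂ) ^ (p + 1)) • M,
    fun t => ?_, ?_⟩
  · have : idealStep H t = evolution K t := rfl
    beta_reduce
    rw [this, add_comm, sub_sub, sub_add_cancel, ← mul_assoc, evolution_mul_neg, one_mul]
  · have h1 := isBigO_evolution_mul_sub_one K (-1)
    have h0 := isBigO_one_of_isBigO_sub_one h1
    have e1 := h0.mul h
    have e2 := h1.mul (isBigO_pow_smul (p + 1) M)
    simp only [one_mul, ← pow_succ'] at e1 e2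
    refine (e1.add e2).congr_left fun t => ?_
    have hs : ((t : ℂ) ^ (p + 1)) • M = t ^ (p + 1) • M := by
      rw [← Complex.ofReal_pow, Complex.coe_smul]
    rw [hs, neg_one_mul, mul_sub, mul_sub, evolution_neg_mul]
    generalize t ^ (p + 1) • M = X
    noncomm_ring

/-! ### The Suzuki formulas -/

theorem isBigO_sq_of_sum_eq_one (H : Fin L → Op N) (stages : List (ℝ × Equiv.Perm (Fin L)))
    (h : (stages.map Prod.fst).sum = 1) :
    (fun t => productFormula H stages t - idealStep H t) =O[nhds 0] fun t : ℝ => t ^ 2 := by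
  have hP := isStep_productFormula H stages
  have hE := isStep_evolution (∑ l, H l)
  refine isBigO_sq_of_hasDerivAt_zero (hP.analyticAt.sub hE.analyticAt) ?_ ?_
  · exact sub_eq_zero.2 (hP.apply_zero.trans hE.apply_zero.symm)
  · have hd := hP.hasDerivAt.sub hE.hasDerivAt
    rw [h, Complex.ofReal_one, mul_one, sub_self] at hd
    exact hd

theorem suzuki_coefficient {m : ℕ} (hm : Odd m) (h1 : 1 < m) {q : ℝ}
    (hq : q = 1 / (4 - (4 : ℝ) ^ ((1 : ℝ) / m))) :
    q ^ m + q ^ m + (1 - 4 * q) ^ m + q ^ m + q ^ m = 0 := by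
  set x : ℝ := (4 : ℝ) ^ ((1 : ℝ) / m) with hx
  have hm0 : (m : ℝ) ≠ 0 := by positivity
  have hxm : x ^ m = 4 := by
    rw [hx, ← Real.rpow_natCast, ← Real.rpow_mul (by norm_num), one_div_mul_cancel hm0,
      Real.rpow_one]
  have hne : 4 - x ≠ 0 := by
    intro h0
    have h4 : x = 4 := by linarith
    rw [h4] at hxm
    have : (4 : ℝ) ^ 1 < 4 ^ m := pow_lt_pow_right₀ (by norm_num) h1
    rw [hxm] at this
    norm_num at this
  -- The choice of `q` makes the middle step `-4^{1/m} q`, whose odd `m`-th power `-4 q^m` cancels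
  -- the four outer ones.
  have h2 : 1 - 4 * q = -(x * q) := by
    rw [hq]
    field_simp
    ring
  rw [h2, hm.neg_pow, mul_pow, hxm]
  ring

theorem productFormula_suzukiStages_succ (H : Fin L → Op N) (n : ℕ) :
    ∃ q : ℝ, q = 1 / (4 - (4 : ℝ) ^ ((1 : ℝ) / (2 * n + 3 : ℕ))) ∧
      ∀ t, productFormula H (suzukiStages L (n + 1)) t =
        productFormula H (suzukiStages L n) (q * t) * productFormula H (suzukiStages L n) (q * t) *
        productFormula H (suzukiStages L n) ((1 - 4 * q) * t) *
        productFormula H (suzukiStages L n) (q * t) * productFormula H (suzukiStages L n) (q * t) := by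
  refine ⟨_, rfl, fun t => ?_⟩
  have he : (2 * ((n : ℝ) + 2) - 1) = (2 * n + 3 : ℕ) := by push_cast; ring
  simp only [suzukiStages, productFormula_append, productFormula_scaleStages, he]

theorem prod_map_reverse_mul_prod_map {M ι : Type*} [Monoid M] {f g : ι → M}
    (h : ∀ i, g i * f i = 1) (l : List ι) : (l.reverse.map g).prod * (l.map f).prod = 1 := by
  induction l with
  | nil => simp
  | cons i l ih =>
    simp only [List.reverse_cons, List.map_append, List.prod_append, List.map_cons, List.prod_cons,
      List.map_nil, List.prod_nil, mul_one]
    rw [mul_assoc, ← mul_assoc (g i), h, one_mul, ih]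

theorem productFormula_suzukiStages_symm (H : Fin L → Op N) (n : ℕ) (t : ℝ) :
    productFormula H (suzukiStages L n) (-t) * productFormula H (suzukiStages L n) t = 1 := by
  induction n generalizing t with
  | zero =>
    set g : ℝ → Fin L → Op N := fun t l => evolution (H l) (1 / 2 * t) with hg
    have hgg : ∀ l, g (-t) l * g t l = 1 := fun l => by
      rw [hg]
      beta_reduce
      rw [mul_neg, evolution_neg_mul]
    have hform : ∀ t, productFormula H (suzukiStages L 0) t =
        ((List.finRange L).map (g t)).prod * ((List.finRange L).reverse.map (g t)).prod := by
      intro t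
      rw [productFormula_eq, suzukiStages, List.finRange_reverse, List.map_map]
      simp only [evolution_smul]
      simp [hg, Function.comp_def]
    have h1 := prod_map_reverse_mul_prod_map hgg (List.finRange L)
    have h2 := prod_map_reverse_mul_prod_map hgg (List.finRange L).reverse
    rw [List.reverse_reverse] at h2
    rw [hform, hform, mul_assoc, ← mul_assoc _ _ (List.prod _), h1, one_mul, h2]
  | succ n ih =>
    have hcancel : ∀ (c : ℝ) (X : Op N), productFormula H (suzukiStages L n) (c * -t) *
        (productFormula H (suzukiStages L n) (c * t) * X) = X := by
      intro c X
      rw [← mul_assoc, mul_neg, ih, one_mul]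
    obtain ⟨q, -, hq⟩ := productFormula_suzukiStages_succ H n
    simp only [hq, mul_assoc, hcancel]
    rw [mul_neg, ih]

theorem exists_hasExpansion_suzukiStages (H : Fin L → Op N) (n : ℕ) :
    ∃ M, HasExpansion (∑ l, H l) (2 * n + 3) (productFormula H (suzukiStages L n)) 1 M := by
  -- Symmetry removes the coefficient at the even power `2n + 2`, so an error of that order has its
  -- first coefficient at `2n + 3`, which is `p + 1` for `p = 2(n + 1)`.
  have key : ∀ n : ℕ, (fun t => productFormula H (suzukiStages L n) t - idealStep H t)
        =O[nhds 0] (fun t : ℝ => t ^ (2 * n + 2)) →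
      ∃ M, HasExpansion (∑ l, H l) (2 * n + 3) (productFormula H (suzukiStages L n)) 1 M := by
    intro n h
    obtain ⟨M, hM⟩ := exists_hasExpansion H _ h
    obtain rfl := hM.eq_zero_of_symmetric (by omega) ⟨n + 1, by ring⟩
      (productFormula_suzukiStages_symm H n)
    exact exists_hasExpansion H _ hM.isBigO_sub
  induction n with
  | zero =>
    exact key 0 (isBigO_sq_of_sum_eq_one H _ (by norm_num [suzukiStages]))
  | succ n ih =>
    obtain ⟨M, hM⟩ := ih
    obtain ⟨q, hq, hform⟩ := productFormula_suzukiStages_succ H n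
    have h1 := hM.comp_mul q
    have h2 := hM.comp_mul (1 - 4 * q)
    have hm : 1 ≤ 2 * n + 3 := by omega
    have h := (((h1.mul hm h1).mul hm h2).mul hm h1).mul hm h1
    have hzero := suzuki_coefficient (m := 2 * n + 3) ⟨n + 1, by ring⟩ (by omega) hq
    simp only [← add_smul, hzero, zero_smul] at h
    rw [show q * 1 + q * 1 + (1 - 4 * q) * 1 + q * 1 + q * 1 = 1 by ring, ← funext hform] at h
    exact key (n + 1) h.isBigO_sub

/-! ### The multiplicative error of one step -/

/-- Left and right multiplicative errors share the leading term: they are conjugate by `U₀ = 1 +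
O(t)`. In the left convention, writing `V = U₀`, the discrepancy satisfies `(E - X) V = [V - 1, X] +
V R`. The bound `δ₀ ≤ 1` serves later comparisons of powers of `t`. -/
theorem exists_norm_error_sub_le {H : Fin L → Op N} (hH : ∀ l, (H l).IsHermitian)
    {stages : List (ℝ × Equiv.Perm (Fin L))} {p : ℕ} {M : Op N}
    (hM : IsLeadingError H stages p M) :
    ∃ c δ₀ : ℝ, 0 ≤ c ∧ 0 < δ₀ ∧ δ₀ ≤ 1 ∧ ∀ t : ℝ, 0 < t → t < δ₀ → ∀ E : Op N,
      (productFormula H stages t = idealStep H t * (1 + E) ∨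
        productFormula H stages t = (1 + E) * idealStep H t) →
      ‖E - ((t ^ (p + 1) : ℝ) : ℂ) • M‖ ≤ c * t ^ (p + 2) := by
  obtain ⟨R, hR, hRO⟩ := hM
  obtain ⟨c₁, hc₁, h₁⟩ := hRO.exists_nonneg
  obtain ⟨c₂, hc₂, h₂⟩ := (isStep_evolution (∑ l, H l)).isBigO_sub_one.exists_nonneg
  obtain ⟨δ, hδ, hball⟩ := Metric.eventually_nhds_iff.1 (h₁.bound.and h₂.bound)
  refine ⟨c₁ + 2 * c₂ * ‖M‖, min δ 1, by positivity, lt_min hδ one_pos, min_le_right _ _,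
    fun t ht htδ E hE => ?_⟩
  obtain ⟨hb₁, hb₂⟩ := hball (y := t) (by
    rw [Real.dist_eq, sub_zero, abs_of_pos ht]
    exact htδ.trans_le (min_le_left _ _))
  rw [Real.norm_of_nonneg (by positivity)] at hb₁ hb₂
  set V := idealStep H t with hVdef
  have hV : V ∈ unitary (Op N) := idealStep_mem_unitary hH t
  change ‖V - 1‖ ≤ c₂ * t at hb₂
  have hVV : star V * V = 1 := Unitary.star_mul_self_of_mem hV
  have hU := hR t
  rw [← hVdef, ← Complex.ofReal_pow] at hU
  set X : Op N := ((t ^ (p + 1) : ℝ) : ℂ) • M with hX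
  rcases hE with hE | hE
  · have h : 1 + E = 1 + X + R t := by
      have := congrArg (star V * ·) (hE.symm.trans hU)
      simpa only [← mul_assoc, hVV, one_mul] using this
    have h' : E - X = R t := by
      rw [add_assoc] at h
      rw [add_left_cancel h, add_sub_cancel_left]
    rw [h']
    refine hb₁.trans ?_
    gcongr
    have : 0 ≤ 2 * c₂ * ‖M‖ := by positivity
    linarith
  · have h : (E - X) * V = ((V - 1) * X - X * (V - 1)) + V * R t := by
      have := hE.symm.trans hU
      rw [add_mul, one_mul, mul_add, mul_add, mul_one, add_assoc] at this
      rw [sub_mul, add_left_cancel this]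
      noncomm_ring
    have hXn : ‖X‖ = t ^ (p + 1) * ‖M‖ := by
      rw [hX, norm_smul, Complex.norm_real, Real.norm_of_nonneg (by positivity)]
    rw [← CStarRing.norm_mul_mem_unitary (E - X) hV, h]
    calc _ ≤ ‖V - 1‖ * ‖X‖ + ‖X‖ * ‖V - 1‖ + ‖R t‖ := by
          refine (norm_add_le _ _).trans (add_le_add ((norm_sub_le _ _).trans
            (add_le_add (norm_mul_le _ _) (norm_mul_le _ _))) ?_)
          rw [CStarRing.norm_mem_unitary_mul _ hV]
      _ ≤ c₂ * t * ‖X‖ + ‖X‖ * (c₂ * t) + c₁ * t ^ (p + 2) := by gcongr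
      _ = _ := by
          rw [hXn]
          ring

/-! ### The error of one step -/

theorem norm_act_unitary {V : Op N} (hV : V ∈ unitary (Op N)) (φ : QState N) :
    ‖act V φ‖ = ‖φ‖ := by
  have h : inner ℂ (act V φ) (act V φ) = inner ℂ φ φ := by
    rw [inner_act_left, ← act_mul, ← Matrix.star_eq_conjTranspose,
      Unitary.star_mul_self_of_mem hV]
    simp [act]
  rw [inner_self_eq_norm_sq_to_K, inner_self_eq_norm_sq_to_K] at h
  have h' : ‖act V φ‖ ^ 2 = ‖φ‖ ^ 2 := by exact_mod_cast h
  exact (pow_left_inj₀ (norm_nonneg _) (norm_nonneg _) two_ne_zero).1 h'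

theorem norm_normalize_le (v : QState N) : ‖normalize v‖ ≤ 1 := by
  by_cases h : v = 0
  · simp [h, normalize]
  · exact (norm_normalize h).le

theorem norm_inner_act_le (A : Op N) {φ : QState N} (hφ : ‖φ‖ = 1) :
    ‖inner ℂ φ (act A φ)‖ ≤ ‖act A φ‖ := by
  simpa [hφ] using norm_inner_le_norm (𝕜 := ℂ) φ (act A φ)

theorem entFactor_nonneg {m : ℕ} (A : Fin m → Op N) (χ : QState N) : 0 ≤ entFactor A χ :=
  Real.sqrt_nonneg _

theorem norm_act_le_of_norm_sub_le {E M : Op N} {τ η : ℝ} (hτ : 0 ≤ τ)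
    (h : ‖E - (τ : ℂ) • M‖ ≤ η) (v : QState N) :
    ‖act E v‖ ≤ τ * ‖act M v‖ + η * ‖v‖ := by
  have : act E v = (τ : ℂ) • act M v + act (E - (τ : ℂ) • M) v := by
    rw [act_sub, smul_act]
    abel
  rw [this]
  refine (norm_add_le _ _).trans (add_le_add ?_ ?_)
  · rw [norm_smul, Complex.norm_real, Real.norm_of_nonneg hτ]
  · exact (norm_act_le _ _).trans (mul_le_mul_of_nonneg_right h (norm_nonneg _))

theorem norm_conjTranspose_mul_mul {V : Op N} (hV : V ∈ unitary (Op N)) (O : Op N) :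
    ‖Vᴴ * O * V‖ = ‖O‖ := by
  rw [CStarRing.norm_mul_mem_unitary _ hV, ← Matrix.star_eq_conjTranspose,
    CStarRing.norm_mem_unitary_mul _ (Unitary.star_mem hV)]

/-- The contribution `|⟨φ|(1+F) O' (1+F)† - O'|φ⟩|` of one step, where `O' = V† O V`, `1 + F` is
unitary and both `F` and `E` are close to `τ M`. -/
theorem norm_inner_step_le {m n : ℕ} {Os : Fin m → Op N} {Ms : Fin n → Op N} {O M V E F : Op N}
    (hO : O = ∑ j, Os j) (hM : M = ∑ j, Ms j) (hV : V ∈ unitary (Op N))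
    (hF : Fᴴ = -F - Fᴴ * F) {τ η : ℝ} (hτ : 0 ≤ τ) (hEM : ‖E - (τ : ℂ) • M‖ ≤ η)
    (hFM : ‖F - (τ : ℂ) • M‖ ≤ η) {φ : QState N} (hφ : ‖φ‖ = 1) :
    ‖inner ℂ φ (act ((1 + F) * (Vᴴ * O * V) * (1 + Fᴴ) - Vᴴ * O * V) φ)‖ ≤
      (entFactor Os (act V φ) * entFactor Ms (normalize (act (Vᴴ * O * V) φ)) +
        entFactor Os (normalize (act V (act E φ))) * entFactor Ms φ) * τ +
      ‖O‖ * (6 * η + 2 * ‖F‖ ^ 2) := by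
  have hη : 0 ≤ η := (norm_nonneg _).trans hEM
  set P : Op N := Vᴴ * O * V with hP
  have hPn : ‖P‖ = ‖O‖ := norm_conjTranspose_mul_mul hV O
  have hVs : Vᴴ ∈ unitary (Op N) := Unitary.star_mem hV
  have hPact : ∀ v, ‖act P v‖ = ‖act O (act V v)‖ := by
    intro v
    rw [hP, mul_assoc, act_mul, norm_act_unitary hVs, act_mul]
  set G : Op N := F - E with hG
  have hGn : ‖G‖ ≤ 2 * η := by
    have : G = (F - (τ : ℂ) • M) - (E - (τ : ℂ) • M) := by
      rw [hG]
      abel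
    rw [this]
    exact (norm_sub_le _ _).trans (by linarith)
  set X : Op N := G * P - P * G - P * (Fᴴ * F) + F * P * Fᴴ with hX
  -- Unitarity eliminates the linear `F†`, leaving `[F, P]` plus quadratic terms; replacing `F` by
  -- `E` costs `[G, P]`. So `X` contributes `4η`, and each half of `[E, P]` a further `η`, for a
  -- total of `6η`.
  have hD : (1 + F) * P * (1 + Fᴴ) - P = E * P - P * E + X := by
    have h1 : (1 + F) * P * (1 + Fᴴ) - P = F * P + P * Fᴴ + F * P * Fᴴ := by noncomm_ring
    have h2 : P * Fᴴ = P * (-F - Fᴴ * F) := by rw [← hF]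
    rw [h1, h2, hX, hG]
    noncomm_ring
  have hXn : ‖X‖ ≤ ‖O‖ * (4 * η + 2 * ‖F‖ ^ 2) := by
    have hFs : ‖Fᴴ‖ = ‖F‖ := Matrix.l2_opNorm_conjTranspose F
    calc ‖X‖ ≤ ‖G‖ * ‖P‖ + ‖P‖ * ‖G‖ + ‖P‖ * (‖Fᴴ‖ * ‖F‖) + ‖F‖ * ‖P‖ * ‖Fᴴ‖ := by
          refine (norm_add_le _ _).trans (add_le_add ((norm_sub_le _ _).trans (add_le_add
            ((norm_sub_le _ _).trans (add_le_add (norm_mul_le _ _) (norm_mul_le _ _))) ?_)) ?_)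
          · exact (norm_mul_le _ _).trans
              (mul_le_mul_of_nonneg_left (norm_mul_le _ _) (norm_nonneg _))
          · exact (norm_mul_le _ _).trans
              (mul_le_mul_of_nonneg_right (norm_mul_le _ _) (norm_nonneg _))
      _ = ‖O‖ * (2 * ‖G‖ + 2 * ‖F‖ ^ 2) := by
          rw [hPn, hFs]
          ring
      _ ≤ _ := mul_le_mul_of_nonneg_left (by linarith) (norm_nonneg _)
  have hfirst : ‖inner ℂ φ (act (E * P) φ)‖ ≤
      entFactor Os (act V φ) * entFactor Ms (normalize (act P φ)) * τ + ‖O‖ * η := by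
    refine (norm_inner_act_le _ hφ).trans ?_
    rw [act_mul]
    refine (norm_act_le_of_norm_sub_le hτ hEM _).trans ?_
    have h1 : ‖act P φ‖ ≤ entFactor Os (act V φ) := by
      rw [hPact, hO]
      exact norm_act_le_entFactor Os _ (by rw [norm_act_unitary hV, hφ])
    have h2 : ‖act P φ‖ ≤ ‖O‖ := by simpa [hφ, hPn] using norm_act_le P φ
    have h3 : ‖act M (act P φ)‖ ≤
        entFactor Os (act V φ) * entFactor Ms (normalize (act P φ)) := by
      rw [hM]
      exact (norm_act_le_mul_entFactor Ms _).trans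
        (mul_le_mul_of_nonneg_right h1 (entFactor_nonneg _ _))
    rw [mul_comm τ, mul_comm η]
    gcongr
  have hsecond : ‖inner ℂ φ (act (P * E) φ)‖ ≤
      entFactor Os (normalize (act V (act E φ))) * entFactor Ms φ * τ + ‖O‖ * η := by
    refine (norm_inner_act_le _ hφ).trans ?_
    rw [act_mul, hPact]
    set w := act V (act E φ) with hw
    -- The size of `w` supplies the factor for `M`, and its direction the error-modified hybrid
    -- state at which `O` is evaluated.
    have h1 : ‖w‖ ≤ τ * entFactor Ms φ + η := by
      rw [hw, norm_act_unitary hV]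
      refine (norm_act_le_of_norm_sub_le hτ hEM _).trans ?_
      rw [hφ, mul_one, hM]
      gcongr
      exact norm_act_le_entFactor Ms φ hφ
    have h2 : ‖act O (normalize w)‖ ≤ ‖O‖ :=
      (norm_act_le _ _).trans (mul_le_of_le_one_right (norm_nonneg _) (norm_normalize_le w))
    have h3 : ‖act O (normalize w)‖ ≤ entFactor Os (normalize w) := by
      by_cases h : w = 0
      · simp [h, normalize, act, entFactor_nonneg]
      · rw [hO]
        exact norm_act_le_entFactor Os _ (norm_normalize h)
    have h4 : 0 ≤ τ * entFactor Ms φ := mul_nonneg hτ (entFactor_nonneg _ _)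
    calc ‖act O w‖ = ‖w‖ * ‖act O (normalize w)‖ := norm_act_eq_norm_mul O w
      _ ≤ (τ * entFactor Ms φ + η) * ‖act O (normalize w)‖ := by gcongr
      _ = τ * entFactor Ms φ * ‖act O (normalize w)‖ + η * ‖act O (normalize w)‖ := add_mul _ _ _
      _ ≤ τ * entFactor Ms φ * entFactor Os (normalize w) + η * ‖O‖ := by gcongr
      _ = _ := by ring
  have hthird : ‖inner ℂ φ (act X φ)‖ ≤ ‖O‖ * (4 * η + 2 * ‖F‖ ^ 2) := by
    refine (norm_inner_act_le _ hφ).trans ((norm_act_le _ _).trans ?_)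
    rwa [hφ, mul_one]
  rw [hD, act_add, act_sub, inner_add_right, inner_sub_right]
  refine (norm_add_le _ _).trans ((add_le_add_left (norm_sub_le _ _) _).trans ?_)
  linarith

/-! ### Telescoping over the steps -/

/-- Since `U₀ = (1 + F)† U`, the next hybrid evolution is `U₀^k (1 + F†) U^{r-k}`. Both terms are
therefore expectations in the same state `U^{r-k} ψ`. -/
theorem telescope_step {U₀ U F O : Op N} (hU₀ : U₀ ∈ unitary (Op N)) (hU : U ∈ unitary (Op N))
    (hF : U = (1 + F) * U₀) {r k : ℕ} (hk : k < r) :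
    (U₀ ^ (k + 1) * U ^ (r - (k + 1)))ᴴ * O * (U₀ ^ (k + 1) * U ^ (r - (k + 1))) -
        (U₀ ^ k * U ^ (r - k))ᴴ * O * (U₀ ^ k * U ^ (r - k)) =
      (U ^ (r - k))ᴴ * ((1 + F) * ((U₀ ^ k)ᴴ * O * U₀ ^ k) * (1 + Fᴴ) -
        (U₀ ^ k)ᴴ * O * U₀ ^ k) * U ^ (r - k) := by
  have h1F : (1 + F) = U * star U₀ := by
    rw [hF, mul_assoc, Unitary.mul_star_self_of_mem hU₀, mul_one]
  have h1F' : 1 + Fᴴ = U₀ * star U := by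
    have := congrArg star h1F
    rwa [star_add, star_one, star_mul, star_star, Matrix.star_eq_conjTranspose F] at this
  have hrk : r - k = (r - (k + 1)) + 1 := by omega
  have hB : U₀ ^ (k + 1) * U ^ (r - (k + 1)) = U₀ ^ k * ((1 + Fᴴ) * U ^ (r - k)) := by
    rw [h1F', hrk, pow_succ' U, mul_assoc U₀, ← mul_assoc (star U),
      Unitary.star_mul_self_of_mem hU, one_mul, pow_succ, mul_assoc]
  have hB' : (1 + Fᴴ)ᴴ = 1 + F := by simp
  rw [hB, Matrix.conjTranspose_mul, Matrix.conjTranspose_mul, Matrix.conjTranspose_mul, hB']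
  noncomm_ring

theorem conjTranspose_eq_of_unitary_one_add {F : Op N} (h : 1 + F ∈ unitary (Op N)) :
    Fᴴ = -F - Fᴴ * F := by
  have h1 := Unitary.star_mul_self_of_mem h
  rw [star_add, star_one, Matrix.star_eq_conjTranspose] at h1
  have h2 : Fᴴ + F + Fᴴ * F = (1 + Fᴴ) * (1 + F) - 1 := by noncomm_ring
  rw [h1, sub_self] at h2
  rw [eq_sub_iff_add_eq, eq_neg_iff_add_eq_zero, ← h2]
  abel

theorem obsError_le_sum {m n : ℕ} {Os : Fin m → Op N} {Ms : Fin n → Op N} {O M U₀ U E F : Op N}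
    (hO : O = ∑ j, Os j) (hM : M = ∑ j, Ms j) (hU₀ : U₀ ∈ unitary (Op N))
    (hU : U ∈ unitary (Op N)) (hF : U = (1 + F) * U₀) {τ η : ℝ} (hτ : 0 ≤ τ)
    (hEM : ‖E - (τ : ℂ) • M‖ ≤ η) (hFM : ‖F - (τ : ℂ) • M‖ ≤ η) {ψ : QState N} (hψ : ‖ψ‖ = 1)
    (r : ℕ) :
    obsError U₀ U O r ψ ≤ ∑ k ∈ Finset.range r,
      ((entFactor Os (hybridState U₀ U r k ψ) * entFactor Ms (stepObsState U₀ U O r k ψ) +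
        entFactor Os (hybridErrorState U₀ U E r k ψ) * entFactor Ms (stepState U r k ψ)) * τ +
      ‖O‖ * (6 * η + 2 * ‖F‖ ^ 2)) := by
  have h1F : 1 + F ∈ unitary (Op N) := by
    have : (1 + F) = U * star U₀ := by
      rw [hF, mul_assoc, Unitary.mul_star_self_of_mem hU₀, mul_one]
    rw [this]
    exact mul_mem hU (Unitary.star_mem hU₀)
  have htel : (U₀ ^ r)ᴴ * O * U₀ ^ r - (U ^ r)ᴴ * O * U ^ r =
      ∑ k ∈ Finset.range r, (U ^ (r - k))ᴴ * ((1 + F) * ((U₀ ^ k)ᴴ * O * U₀ ^ k) * (1 + Fᴴ) -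
        (U₀ ^ k)ᴴ * O * U₀ ^ k) * U ^ (r - k) := by
    rw [← Finset.sum_congr rfl fun k hk => telescope_step hU₀ hU hF (Finset.mem_range.1 hk),
      Finset.sum_range_sub
        fun k => (U₀ ^ k * U ^ (r - k))ᴴ * O * (U₀ ^ k * U ^ (r - k))]
    simp
  have hact : act ((U₀ ^ r)ᴴ * O * U₀ ^ r - (U ^ r)ᴴ * O * U ^ r) ψ =
      ∑ k ∈ Finset.range r, act ((U ^ (r - k))ᴴ * ((1 + F) * ((U₀ ^ k)ᴴ * O * U₀ ^ k) * (1 + Fᴴ) -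
        (U₀ ^ k)ᴴ * O * U₀ ^ k) * U ^ (r - k)) ψ := by
    rw [htel]
    simp only [act, map_sum, sum_apply]
  rw [obsError, hact, inner_sum]
  refine (norm_sum_le _ _).trans (Finset.sum_le_sum fun k _ => ?_)
  have hφ : ‖stepState U r k ψ‖ = 1 := by
    rw [stepState, norm_act_unitary (pow_mem hU _), hψ]
  have h := norm_inner_step_le hO hM (pow_mem hU₀ k) (conjTranspose_eq_of_unitary_one_add h1F)
    hτ hEM hFM hφ
  rw [mul_assoc, act_mul, ← inner_act_left, act_mul]
  simpa only [stepState, hybridState, hybridErrorState, stepObsState, act_mul] using h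

end Trotter

/-! ### Assembly of the theorem -/

theorem mainTheorem5 {N L : ℕ} (H : Fin L → Trotter.Op N) (hH : ∀ l, (H l).IsHermitian) :
    -- the first-order formula and the Suzuki formulas have a leading error at their order
    (∃ M, Trotter.IsLeadingError H (Trotter.firstOrderStages L) 1 M) ∧
    (∀ n : ℕ, ∃ M, Trotter.IsLeadingError H (Trotter.suzukiStages L n) (2 * (n + 1)) M) ∧
    -- the bound, for every product formula with leading error `M` at order `p`
    ∀ (stages : List (ℝ × Equiv.Perm (Fin L))) (p : ℕ) (M : Trotter.Op N), 1 ≤ p →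
      Trotter.IsLeadingError H stages p M →
      ∃ C δ₀ : ℝ, 0 < δ₀ ∧
        ∀ (O : Trotter.Op N), O.IsHermitian →
        ∀ (m n : ℕ) (Os : Fin m → Trotter.Op N) (Ms : Fin n → Trotter.Op N),
          O = ∑ j, Os j → M = ∑ j, Ms j →
        ∀ (ψ : Trotter.QState N), ‖ψ‖ = 1 →
        ∀ (r : ℕ) (δt : ℝ), 0 < δt → δt < δ₀ →
        ∀ (U₀ U E : Trotter.Op N),
          U₀ = Trotter.idealStep H δt → U = Trotter.productFormula H stages δt →
          (U = U₀ * (1 + E) ∨ U = (1 + E) * U₀) →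
          Trotter.obsError U₀ U O r ψ ≤
            (∑ k ∈ Finset.range r,
              (Trotter.entFactor Os (Trotter.hybridState U₀ U r k ψ) *
                  Trotter.entFactor Ms (Trotter.stepObsState U₀ U O r k ψ) +
                Trotter.entFactor Os (Trotter.hybridErrorState U₀ U E r k ψ) *
                  Trotter.entFactor Ms (Trotter.stepState U r k ψ)) * δt ^ (p + 1)) +
            C * ‖O‖ * r * δt ^ (p + 2) := by
  refine ⟨?_, fun n => ?_, ?_⟩
  · obtain ⟨M, hM⟩ := Trotter.exists_hasExpansion H (Trotter.firstOrderStages L)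
      (Trotter.isBigO_sq_of_sum_eq_one H _ (by simp [Trotter.firstOrderStages]))
    exact ⟨M, hM.isLeadingError⟩
  · obtain ⟨M, hM⟩ := Trotter.exists_hasExpansion_suzukiStages H n
    exact ⟨M, Trotter.HasExpansion.isLeadingError (p := 2 * (n + 1)) hM⟩
  intro stages p M _ hlead
  obtain ⟨c, δ₀, hc, hδ₀, hδ₁, hbound⟩ := Trotter.exists_norm_error_sub_le hH hlead
  -- Here `6c` comes from `6η` with `η = c δt^{p+2}`, and the second term from `2‖F‖²` with `‖F‖ ≤
  -- (‖M‖ + c) δt^{p+1}`.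
  refine ⟨6 * c + 2 * (‖M‖ + c) ^ 2, δ₀, hδ₀, ?_⟩
  intro O _ m n Os Ms hO hM ψ hψ r t ht htδ U₀ U E hU₀ hU hE
  have hU₀u : U₀ ∈ unitary (Trotter.Op N) := hU₀ ▸ Trotter.idealStep_mem_unitary hH t
  have hUu : U ∈ unitary (Trotter.Op N) := hU ▸ Trotter.productFormula_mem_unitary hH stages t
  -- Telescoping always uses the left error `F`, whichever convention defines `E`; `E` itself must
  -- survive in the bound because it enters the error-modified hybrid states.
  set F : Trotter.Op N := U * star U₀ - 1 with hFdef
  have hF : U = (1 + F) * U₀ := by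
    rw [hFdef, add_sub_cancel, mul_assoc, Unitary.star_mul_self_of_mem hU₀u, mul_one]
  have hb := hbound t ht htδ
  rw [← hU₀, ← hU] at hb
  have hEM := hb E hE
  have hFM := hb F (Or.inr hF)
  have ht1 : t ≤ 1 := (htδ.trans_le hδ₁).le
  have hFn : ‖F‖ ≤ (‖M‖ + c) * t ^ (p + 1) := by
    calc ‖F‖ = ‖((t ^ (p + 1) : ℝ) : ℂ) • M + (F - ((t ^ (p + 1) : ℝ) : ℂ) • M)‖ := by
          rw [add_sub_cancel]
      _ ≤ t ^ (p + 1) * ‖M‖ + c * t ^ (p + 2) := by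
          refine (norm_add_le _ _).trans (add_le_add ?_ hFM)
          rw [norm_smul, Complex.norm_real, Real.norm_of_nonneg (by positivity)]
      _ ≤ t ^ (p + 1) * ‖M‖ + c * t ^ (p + 1) := by
          have : t ^ (p + 2) ≤ t ^ (p + 1) := pow_le_pow_of_le_one ht.le ht1 (by omega)
          gcongr
      _ = _ := by ring
  have hFn2 : ‖F‖ ^ 2 ≤ (‖M‖ + c) ^ 2 * t ^ (p + 2) := by
    calc ‖F‖ ^ 2 ≤ ((‖M‖ + c) * t ^ (p + 1)) ^ 2 := by gcongr
      _ = (‖M‖ + c) ^ 2 * t ^ ((p + 1) * 2) := by rw [mul_pow, ← pow_mul]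
      _ ≤ _ := by
          have : t ^ ((p + 1) * 2) ≤ t ^ (p + 2) := pow_le_pow_of_le_one ht.le ht1 (by omega)
          gcongr
  refine (Trotter.obsError_le_sum hO hM hU₀u hUu hF (by positivity) hEM hFM hψ r).trans ?_
  rw [Finset.sum_add_distrib, Finset.sum_const, Finset.card_range, nsmul_eq_mul]
  refine add_le_add_right ?_ _
  calc (r : ℝ) * (‖O‖ * (6 * (c * t ^ (p + 2)) + 2 * ‖F‖ ^ 2))
      ≤ r * (‖O‖ * (6 * (c * t ^ (p + 2)) + 2 * ((‖M‖ + c) ^ 2 * t ^ (p + 2)))) := by gcongr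
    _ = _ := by ring
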